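/- Let $H$ be a complex Hilbert space with a fixed orthonormal basis $\{e_n\}_{n\ge 1}$. Let $\mathcal D\subset B(H)$ be the algebra of bounded operators that are diagonal with respect to $\{e_n\}$, let $\mathcal K$ be the ideal of compact operators, and put $\mathcal D+\mathcal K=\{D+K: D\in\mathcal D,\ K\in\mathcal K\}$. Let $\mathcal P_{\mathcal D+\mathcal K}$ be the set of orthogonal projections belonging to $\mathcal D+\mathcal K$, with the operator norm topology. By a piecewise differentiable curve we mean a norm-continuous map $\gamma:[a,b]\to B(H)$ that is differentiable at all but finitely many parameters; its length is $\ell(\gamma)=\int_a^b\|\dot\gamma(t)\|\,dt\in[0,\infty]$, with $\|\cdot\|$ the operator norm. Let $P,Q$ lie in the same connected component of $\mathcal P_{\mathcal D+\mathcal K}$. Then there exists $X=X^*\in B(H)$ such that: 1. $X$ is compact and $\|X\|\le\pi/2$. 2. The curve $\delta(t)=e^{itX}Pe^{-itX}$, $t\in[0,1]$, satisfies $\delta(0)=P$, $\delta(1)=Q$ and $\delta(t)\in\mathcal P_{\mathcal D+\mathcal K}$ for all $t\in[0,1]$. 3. $\delta$ has minimal length among all piecewise differentiable curves of orthogonal projections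 of $B(H)$ which join $P$ and $Q$. In particular, it has minimal length among all piecewise differentiable curves in $\mathcal P_{\mathcal D+\mathcal K}$ joining $P$ and $Q$. -/

import Mathlib

open MeasureTheory
open scoped ENNReal

namespace DiagCompact

variable {H : Type*} [NormedAddCommGroup H] [InnerProductSpace ℂ H]

/-- Bounded operators that are diagonal with respect to the orthonormal basis `e`
(the entries form a bounded sequence because `D` is bounded). -/
def IsDiagonal (e : HilbertBasis ℕ ℂ H) (D : H →L[ℂ] H) : Prop :=
  ∃ d : ℕ → ℂ, ∀ n, D (e n) = d n • e n

/-- The algebra `𝒟 + 𝒦`: sums of a diagonal operator and a compact operator. -/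
def diagAddCompact (e : HilbertBasis ℕ ℂ H) : Set (H →L[ℂ] H) :=
  {T | ∃ D K : H →L[ℂ] H, IsDiagonal e D ∧ IsCompactOperator K ∧ T = D + K}

/-- The orthogonal projections of `B(H)`. -/
def projections (H : Type*) [NormedAddCommGroup H] [InnerProductSpace ℂ H] [CompleteSpace H] :
    Set (H →L[ℂ] H) :=
  {P | IsStarProjection P}

/-- The orthogonal projections belonging to `𝒟 + 𝒦`. -/
def projectionsDK [CompleteSpace H] (e : HilbertBasis ℕ ℂ H) : Set (H →L[ℂ] H) :=
  {P | P ∈ projections H ∧ P ∈ diagAddCompact e}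

/-- `γ`, restricted to `[a, b]`, is a continuous, piecewise differentiable (that is, differentiable
off a finite set of parameters) curve with values in `S`. -/
structure IsPiecewiseDiffCurve (S : Set (H →L[ℂ] H)) (γ : ℝ → (H →L[ℂ] H)) (a b : ℝ) : Prop where
  le : a ≤ b
  continuousOn : ContinuousOn γ (Set.Icc a b)
  differentiableAt : ∃ F : Finset ℝ, ∀ t ∈ Set.Ioo a b, t ∉ F → DifferentiableAt ℝ γ t
  mem : ∀ t ∈ Set.Icc a b, γ t ∈ S

/-- The length `∫ₐᵇ ‖γ'(t)‖ dt`, measured with the operator norm, as an element of `[0, ∞]`. -/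
noncomputable def curveLength (γ : ℝ → (H →L[ℂ] H)) (a b : ℝ) : ℝ≥0∞ :=
  ∫⁻ t in Set.Icc a b, ‖deriv γ t‖ₑ

/-- `γ` on `[a, b]` is a piecewise differentiable curve in `S`, and no piecewise differentiable
curve in `S` with the same endpoints (on any parameter interval) is shorter. -/
def IsMinimalCurve (S : Set (H →L[ℂ] H)) (γ : ℝ → (H →L[ℂ] H)) (a b : ℝ) : Prop :=
  IsPiecewiseDiffCurve S γ a b ∧
    ∀ (η : ℝ → (H →L[ℂ] H)) (c d : ℝ), IsPiecewiseDiffCurve S η c d →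
      η c = γ a → η d = γ b → curveLength γ a b ≤ curveLength η c d

/-- The curve `t ↦ e^{itX} P e^{-itX}`. -/
noncomputable def expCurve (X P : H →L[ℂ] H) (t : ℝ) : H →L[ℂ] H :=
  NormedSpace.exp ((Complex.I * (t : ℂ)) • X) * P * NormedSpace.exp (-((Complex.I * (t : ℂ)) • X))

end DiagCompact

/-!
Write `R = 2 P - 1` and `S = 2 Q - 1`. A self-adjoint `X` anticommuting with `R` satisfies
`e^{itX} R e^{-itX} = e^{2itX} R`, so the curve `δ` ends at `Q` as soon as `e^{2iX} = S R`; the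
point is to find such a logarithm that is compact and has norm at most `π / 2`.

The unitary `S R` is a compact perturbation of the identity, because `P - Q` is compact: the algebra
`𝒟 + 𝒦` is commutative modulo the compact operators, and in a commutative algebra projections at
distance less than one coincide (`isCompactOperator_sub_of_norm_sub_lt_one`). Off its eigenspace for
`-1`, half of the argument of `S R`, given by the continuous functional calculus, is the required
`X` (`exists_compact_arg`). The eigenspace for `-1` is `ran P ∩ ker Q ⊕ ran Q ∩ ker P`, and an `X`
anticommuting with `R` exists there only if the two summands have the same dimension: it is then
`π / 2` times a self-adjoint operator exchanging them (`exists_exchange`).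

This equality of dimensions is the vanishing of the index of the pair `(P, Q)`, and is where
connectedness is used. Nearby projections of `𝒟 + 𝒦` are conjugate under an invertible `g` with
`g - 1` compact, hence so are all pairs in one connected component
(`compactlyConjugate_of_mem_connectedComponentIn`); and the Fredholm alternative shows that such
pairs have index zero (`finrank_rangeInfKer_eq`).

The curve `δ` has speed `‖X‖`. For the lower bound let `v` be a unit eigenvector of `X` for one of
`±‖X‖`, which exists as `X` is compact. If `η` is any curve of projections from `P` to `Q`, then
`t ↦ (2 η t - 1) (R v)` is a curve on the unit sphere of `H`, of at most twice the length of `η`, from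
`v` to `e^{2iX} v`. The angle between these vectors is `2 ‖X‖ ≤ π`, and a curve on the sphere is at
least as long as the angle it spans (`arccos_inner_le_lintegral_enorm_deriv`).
-/

open MeasureTheory
open scoped ENNReal

namespace DiagCompact

/-! ### Projections in one component are conjugate modulo compact operators -/

section Conjugacy

variable {H : Type*} [NormedAddCommGroup H] [InnerProductSpace ℂ H]

lemma _root_.IsCompactOperator.mul_right {S : H →L[ℂ] H} (hS : IsCompactOperator S)
    (T : H →L[ℂ] H) : IsCompactOperator (S * T : H →L[ℂ] H) :=
  hS.comp_clm T

lemma _root_.IsCompactOperator.mul_left {S : H →L[ℂ] H} (hS : IsCompactOperator S)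
    (T : H →L[ℂ] H) : IsCompactOperator (T * S : H →L[ℂ] H) :=
  hS.clm_comp T

lemma IsDiagonal.commute {e : HilbertBasis ℕ ℂ H} {D D' : H →L[ℂ] H} (hD : IsDiagonal e D)
    (hD' : IsDiagonal e D') : D * D' = D' * D := by
  obtain ⟨d, hd⟩ := hD
  obtain ⟨d', hd'⟩ := hD'
  have hdense : Dense (Submodule.span ℂ (Set.range e) : Set H) := by
    rw [Submodule.dense_iff_topologicalClosure_eq_top, e.dense_span]
  refine ContinuousLinearMap.ext_on hdense ?_
  rintro _ ⟨n, rfl⟩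
  simp [hd, hd', smul_smul, mul_comm]

/-- `𝒟 + 𝒦` is commutative modulo the compact operators. -/
lemma isCompactOperator_commutator {e : HilbertBasis ℕ ℂ H} {S T : H →L[ℂ] H}
    (hS : S ∈ diagAddCompact e) (hT : T ∈ diagAddCompact e) :
    IsCompactOperator (S * T - T * S : H →L[ℂ] H) := by
  obtain ⟨D, K, hD, hK, rfl⟩ := hS
  obtain ⟨D', K', hD', hK', rfl⟩ := hT
  have : (D + K) * (D' + K') - (D' + K') * (D + K)
      = (D * K' + K * (D' + K')) - (K' * (D + K) + D' * K) := by
    simp only [add_mul, mul_add, hD.commute hD']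
    abel
  rw [this]
  exact ((hK'.mul_left D).add (hK.mul_right _)).sub ((hK'.mul_right _).add (hK.mul_left D'))

/-- `P` is carried to `Q` by conjugation with an invertible compact perturbation of the identity. -/
def CompactlyConjugate (P Q : H →L[ℂ] H) : Prop :=
  ∃ g : (H →L[ℂ] H)ˣ, IsCompactOperator (g - 1 : H →L[ℂ] H) ∧ g * P = Q * g

lemma CompactlyConjugate.symm {P Q : H →L[ℂ] H} (h : CompactlyConjugate P Q) :
    CompactlyConjugate Q P := by
  obtain ⟨g, hg, hPQ⟩ := h
  refine ⟨g⁻¹, ?_, ?_⟩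
  · have : ((g⁻¹ : (H →L[ℂ] H)ˣ) - 1 : H →L[ℂ] H) = -((g⁻¹ : (H →L[ℂ] H)ˣ) * (g - 1)) := by
      rw [mul_sub, Units.inv_mul]; simp
    rw [this]
    exact (hg.mul_left _).neg
  · rw [Units.inv_mul_eq_iff_eq_mul, ← mul_assoc, hPQ, Units.mul_inv_cancel_right]

lemma CompactlyConjugate.trans {P Q R : H →L[ℂ] H} (h : CompactlyConjugate P Q)
    (h' : CompactlyConjugate Q R) : CompactlyConjugate P R := by
  obtain ⟨g, hg, hPQ⟩ := h
  obtain ⟨g', hg', hQR⟩ := h'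
  refine ⟨g' * g, ?_, ?_⟩
  · have : ((g' * g : (H →L[ℂ] H)ˣ) - 1 : H →L[ℂ] H) = g' * (g - 1) + (g' - 1) := by
      rw [mul_sub]; simp
    rw [this]
    exact (hg.mul_left _).add hg'
  · rw [Units.val_mul, mul_assoc, hPQ, ← mul_assoc, hQR, mul_assoc]

lemma CompactlyConjugate.isCompactOperator_sub {P Q : H →L[ℂ] H} (h : CompactlyConjugate P Q) :
    IsCompactOperator (P - Q : H →L[ℂ] H) := by
  obtain ⟨g, hg, hPQ⟩ := h
  have : P - Q = Q * (g - 1) - (g - 1) * P := by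
    rw [mul_sub, sub_mul, hPQ]; simp
  rw [this]
  exact (hg.mul_left Q).sub (hg.mul_right P)

variable [CompleteSpace H]

/-- Commuting projections at distance less than one are equal; in the commutative quotient of
`𝒟 + 𝒦` by the compact operators this makes the difference of two nearby projections vanish. The
identity behind it is that `A = P - Q` satisfies `A - A ^ 3 = [P, Q] P - Q [P, Q]`. -/
lemma isCompactOperator_sub_of_norm_sub_lt_one {e : HilbertBasis ℕ ℂ H} {P Q : H →L[ℂ] H}
    (hP : P ∈ projectionsDK e) (hQ : Q ∈ projectionsDK e) (hPQ : ‖P - Q‖ < 1) :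
    IsCompactOperator (P - Q : H →L[ℂ] H) := by
  have hp : P * P = P := hP.1.isIdempotentElem
  have hq : Q * Q = Q := hQ.1.isIdempotentElem
  have hc := isCompactOperator_commutator hP.2 hQ.2
  have hsq : ‖(P - Q) * (P - Q)‖ < 1 :=
    (norm_mul_le _ _).trans_lt (mul_lt_one_of_nonneg_of_lt_one_left (norm_nonneg _) hPQ hPQ.le)
  have key : (P - Q) * (1 - (P - Q) * (P - Q))
      = (P * Q - Q * P) * P - Q * (P * Q - Q * P) := by
    have hp' (x : H →L[ℂ] H) : P * (P * x) = P * x := by rw [← mul_assoc, hp]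
    have hq' (x : H →L[ℂ] H) : Q * (Q * x) = Q * x := by rw [← mul_assoc, hq]
    simp only [mul_sub, sub_mul, mul_one, mul_assoc, hp, hq, hp', hq']
    abel
  have hcomp : IsCompactOperator ((P - Q) * (1 - (P - Q) * (P - Q)) : H →L[ℂ] H) := by
    rw [key]
    exact (hc.mul_right P).sub (hc.mul_left Q)
  have := hcomp.mul_right ((Units.oneSub _ hsq)⁻¹ : (H →L[ℂ] H)ˣ)
  rwa [← Units.val_oneSub _ hsq, Units.mul_inv_cancel_right] at this

/-- The conjugating element is `Q P + (1 - Q) (1 - P)`. -/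
lemma compactlyConjugate_of_norm_sub_lt {e : HilbertBasis ℕ ℂ H} {P Q : H →L[ℂ] H}
    (hP : P ∈ projectionsDK e) (hQ : Q ∈ projectionsDK e) (hPQ : ‖P - Q‖ < 1 / 2) :
    CompactlyConjugate P Q := by
  have hp : P * P = P := hP.1.isIdempotentElem
  have hq : Q * Q = Q := hQ.1.isIdempotentElem
  have hc := isCompactOperator_sub_of_norm_sub_lt_one hP hQ (by linarith)
  set G : H →L[ℂ] H := (P - Q) * P - Q * (P - Q) with hG
  have hGn : ‖G‖ < 1 := by
    have h1 := norm_mul_le (P - Q) P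
    have h2 := norm_mul_le Q (P - Q)
    have h3 := hP.1.norm_le
    have h4 := hQ.1.norm_le
    have := norm_sub_le ((P - Q) * P) (Q * (P - Q))
    nlinarith [norm_nonneg (P - Q)]
  refine ⟨Units.oneSub G hGn, ?_, ?_⟩
  · rw [Units.val_oneSub, sub_sub_cancel_left]
    exact ((hc.mul_right P).sub (hc.mul_left Q)).neg
  · have hq' (x : H →L[ℂ] H) : Q * (Q * x) = Q * x := by rw [← mul_assoc, hq]
    simp only [Units.val_oneSub, hG, mul_sub, sub_mul, mul_one, one_mul, mul_assoc, hp, hq, hq']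
    abel

lemma compactlyConjugate_of_mem_connectedComponentIn {e : HilbertBasis ℕ ℂ H} {P Q : H →L[ℂ] H}
    (hP : P ∈ projectionsDK e) (hPQ : Q ∈ connectedComponentIn (projectionsDK e) P) :
    CompactlyConjugate P Q := by
  have hsub := connectedComponentIn_subset (projectionsDK e) P
  refine isPreconnected_connectedComponentIn.induction₂' CompactlyConjugate ?_ ?_
    (mem_connectedComponentIn hP) hPQ
  · intro R hR
    filter_upwards [self_mem_nhdsWithin,
      mem_nhdsWithin_of_mem_nhds (Metric.ball_mem_nhds R one_half_pos)] with S hS hRS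
    rw [mem_ball_iff_norm'] at hRS
    have := compactlyConjugate_of_norm_sub_lt (hsub hR) (hsub hS) hRS
    exact ⟨this, this.symm⟩
  · exact fun _ _ _ _ _ _ => CompactlyConjugate.trans

end Conjugacy

/-! ### The index of a pair of projections -/

section Index

variable {H : Type*} [NormedAddCommGroup H] [InnerProductSpace ℂ H]

/-- The subspace `ran P ∩ ker Q` attached to two projections, the range of `P` being encoded as the
kernel of `P - 1`. -/
def rangeInfKer (P Q : H →L[ℂ] H) : Submodule ℂ H :=
  LinearMap.ker (P - 1 : H →L[ℂ] H).toLinearMap ⊓ LinearMap.ker Q.toLinearMap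

lemma mem_rangeInfKer {P Q : H →L[ℂ] H} {x : H} : x ∈ rangeInfKer P Q ↔ P x = x ∧ Q x = 0 := by
  simp [rangeInfKer, sub_eq_zero]

lemma isClosed_rangeInfKer (P Q : H →L[ℂ] H) : IsClosed (rangeInfKer P Q : Set H) :=
  (P - 1).isClosed_ker.inter Q.isClosed_ker

/-- `P - Q` restricts to the identity of `ran P ∩ ker Q`. -/
lemma finiteDimensional_rangeInfKer {P Q : H →L[ℂ] H}
    (h : IsCompactOperator (P - Q : H →L[ℂ] H)) : FiniteDimensional ℂ (rangeInfKer P Q) := by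
  apply FiniteDimensional.of_isCompactOperator_id (𝕜 := ℂ)
  have hid (x : rangeInfKer P Q) : (P - Q) x = x := by
    simp [(mem_rangeInfKer.1 x.2).1, (mem_rangeInfKer.1 x.2).2]
  have hmem (x : rangeInfKer P Q) : ((P - Q) ∘ (rangeInfKer P Q).subtypeL) x ∈ rangeInfKer P Q := by
    change (P - Q) x ∈ rangeInfKer P Q
    rw [hid]
    exact x.2
  have := (h.comp_clm (rangeInfKer P Q).subtypeL).codRestrict hmem (isClosed_rangeInfKer P Q)
  have hcod : Set.codRestrict _ _ hmem = id := funext fun x => Subtype.ext (hid x)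
  rwa [hcod] at this

variable [CompleteSpace H]

/-- The Fredholm alternative, for injective perturbations of the identity. -/
lemma surjective_of_injective_of_isCompactOperator_sub_one {S : H →L[ℂ] H}
    (hS : IsCompactOperator (S - 1 : H →L[ℂ] H)) (hinj : Function.Injective S) :
    Function.Surjective S := by
  rcases hS.hasEigenvalue_or_mem_resolventSet (neg_ne_zero.2 (one_ne_zero (α := ℂ))) with h | h
  · obtain ⟨x, hx⟩ := h.exists_hasEigenvector
    refine absurd (hinj (a₁ := x) (a₂ := 0) ?_) hx.2
    simpa [sub_eq_iff_eq_add] using hx.apply_eq_smul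
  · rw [spectrum.mem_resolventSet_iff, ← IsUnit.neg_iff, map_neg, map_one, neg_sub, sub_neg_eq_add,
      sub_add_cancel, ContinuousLinearMap.isUnit_iff_bijective] at h
    exact h.2

lemma inner_apply_left {P : H →L[ℂ] H} (hP : IsStarProjection P) (x y : H) :
    inner ℂ (P x) y = inner ℂ x (P y) :=
  ContinuousLinearMap.isSelfAdjoint_iff_isSymmetric.1 hP.isSelfAdjoint x y

lemma apply_eq_zero_of_apply_apply_eq_zero {P Q : H →L[ℂ] H} (hP : IsStarProjection P)
    (hQ : IsStarProjection Q) {x : H} (hx : P x = x) (h : P (Q x) = 0) : Q x = 0 := by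
  rw [← inner_self_eq_zero (𝕜 := ℂ), inner_apply_left hQ, ← mul_apply_eq_comp,
    hQ.isIdempotentElem.eq]
  nth_rw 1 [← hx]
  rw [inner_apply_left hP, h, inner_zero_right]

/-- The operator `Q P + g (1 - P)` is a compact perturbation of the identity with kernel
`ran P ∩ ker Q` and range orthogonal to `ran Q ∩ ker P`. Adding to it an injection of the first
space into the second gives an injective, hence surjective, operator. -/
lemma finrank_rangeInfKer_eq_of_le {P Q : H →L[ℂ] H} (hP : IsStarProjection P)
    (hQ : IsStarProjection Q) (h : CompactlyConjugate P Q)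
    (hle : Module.finrank ℂ (rangeInfKer P Q) ≤ Module.finrank ℂ (rangeInfKer Q P)) :
    Module.finrank ℂ (rangeInfKer P Q) = Module.finrank ℂ (rangeInfKer Q P) := by
  have hcPQ := h.isCompactOperator_sub
  have hcQP := h.symm.isCompactOperator_sub
  have := finiteDimensional_rangeInfKer hcPQ
  have := finiteDimensional_rangeInfKer hcQP
  obtain ⟨g, hg, hgP⟩ := h
  set N := rangeInfKer P Q
  set M := rangeInfKer Q P
  obtain ⟨f, hf⟩ := finrank_le_iff_exists_linearMap.1 hle
  let F : H →L[ℂ] H := M.subtypeL ∘L f.toContinuousLinearMap ∘L N.orthogonalProjectionOnto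
  let T : H →L[ℂ] H := Q * P + g * (1 - P)
  have hFmem (x : H) : F x ∈ M := (f (N.orthogonalProjectionOnto x)).2
  have hFN (x : N) : F x = f x := by simp [F]
  have hFc : IsCompactOperator F :=
    ((isCompactOperator_of_locallyCompactSpace_dom f.toContinuousLinearMap).comp_clm
      N.orthogonalProjectionOnto).clm_comp M.subtypeL
  have hginj {x : H} (hx : (g : H →L[ℂ] H) x = 0) : x = 0 := by
    have hx' : ((g⁻¹ : (H →L[ℂ] H)ˣ) : H →L[ℂ] H) ((g : H →L[ℂ] H) x) = x :=
      congr($(g.inv_mul) x)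
    rw [← hx', hx, map_zero]
  have hQid (x : H) : Q (Q x) = Q x := congr($(hQ.isIdempotentElem.eq) x)
  have hgP' (x : H) : (g : H →L[ℂ] H) (P x) = Q ((g : H →L[ℂ] H) x) := congr($hgP x)
  -- The range of `T` meets `M` trivially, and the kernel of `T` is contained in `N`.
  have hT (x : H) (hx : T x ∈ M) : x ∈ N ∧ T x = 0 := by
    obtain ⟨h1, h2⟩ := mem_rangeInfKer.1 hx
    have h3 : Q (T x) = Q (P x) := by simp [T, hgP', hQid]
    have h4 : T x - Q (T x) = (g : H →L[ℂ] H) (x - P x) := by rw [h3]; simp [T]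
    rw [h1, sub_self] at h4
    have h5 : P x = x := (sub_eq_zero.1 (hginj h4.symm)).symm
    rw [h5, h1] at h3
    have h6 : Q x = 0 := apply_eq_zero_of_apply_apply_eq_zero hP hQ h5 (by rw [← h3, h2])
    exact ⟨mem_rangeInfKer.2 ⟨h5, h6⟩, by rw [h3, h6]⟩
  have hTF (x : H) : (T + F) x = T x + F x := rfl
  have hcomp : IsCompactOperator (T + F - 1 : H →L[ℂ] H) := by
    have : T + F - 1 = (g - 1) * (1 - P) + (Q - P) * P + F := by
      simp only [T, mul_sub, sub_mul, mul_one, one_mul, hP.isIdempotentElem.eq]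
      abel
    rw [this]
    exact ((hg.mul_right _).add (hcQP.mul_right P)).add hFc
  have hinj : Function.Injective (T + F : H →L[ℂ] H) := by
    rw [injective_iff_map_eq_zero]
    intro x hx
    rw [hTF] at hx
    obtain ⟨hxN, hTx⟩ := hT x (by rw [eq_neg_of_add_eq_zero_left hx]; exact M.neg_mem (hFmem x))
    rw [hTx, zero_add, hFN ⟨x, hxN⟩] at hx
    simpa using hf ((Subtype.ext hx).trans (map_zero f).symm)
  have hsurj := surjective_of_injective_of_isCompactOperator_sub_one hcomp hinj
  refine (LinearEquiv.ofBijective f ⟨hf, fun y => ?_⟩).finrank_eq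
  obtain ⟨x, hx⟩ := hsurj y
  rw [hTF] at hx
  obtain ⟨hxN, hTx⟩ := hT x (by rw [eq_sub_of_add_eq hx]; exact M.sub_mem y.2 (hFmem x))
  rw [hTx, zero_add, hFN ⟨x, hxN⟩] at hx
  exact ⟨⟨x, hxN⟩, Subtype.ext hx⟩

lemma finrank_rangeInfKer_eq {P Q : H →L[ℂ] H} (hP : IsStarProjection P)
    (hQ : IsStarProjection Q) (h : CompactlyConjugate P Q) :
    Module.finrank ℂ (rangeInfKer P Q) = Module.finrank ℂ (rangeInfKer Q P) :=
  (le_total _ _).elim (finrank_rangeInfKer_eq_of_le hP hQ h)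
    fun hle => (finrank_rangeInfKer_eq_of_le hQ hP h.symm hle).symm

end Index

/-! ### Exponentials and arguments of compact perturbations of the identity -/

section Argument

section Exponential

variable {A : Type*} [NormedRing A] [NormedAlgebra ℂ A] [CompleteSpace A]

lemma hasSum_exp_sub_one (a : A) :
    HasSum (fun n : ℕ => ((n + 1).factorial⁻¹ : ℂ) • a ^ (n + 1)) (NormedSpace.exp a - 1) := by
  have h := (hasSum_nat_add_iff' 1).2 (NormedSpace.exp_series_hasSum_exp' (𝕂 := ℂ) a)
  simpa using h

lemma exp_smul_of_isIdempotentElem {p : A} (hp : IsIdempotentElem p) (z : ℂ) :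
    NormedSpace.exp (z • p) = 1 + (Complex.exp z - 1) • p := by
  have h := hasSum_exp_sub_one (z • p)
  have h' := (hasSum_exp_sub_one z).smul_const p
  simp only [smul_pow, hp.pow_succ_eq, smul_smul] at h
  rw [← Complex.exp_eq_exp_ℂ] at h'
  have := h.unique (by simpa only [smul_smul, smul_eq_mul] using h')
  rw [← this, add_sub_cancel]

/-- A symmetry `J` of the range of the idempotent `E` has the form `E - 2 p` with `p` idempotent,
so that `exp (π i J) = exp (π i E)` acts as `-1` on that range. -/
lemma exp_pi_mul_I_smul {J E : A} (hJ : J * J = E) (hE : E * E = E) (hEJ : E * J = J)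
    (hJE : J * E = J) :
    NormedSpace.exp ((Real.pi * Complex.I : ℂ) • J) = 1 - (2 : ℂ) • E := by
  set p : A := (1 / 2 : ℂ) • (E - J) with hp
  have hpp : IsIdempotentElem p := by
    change p * p = p
    simp only [hp, smul_mul_smul_comm, mul_sub, sub_mul, hJ, hE, hEJ, hJE]
    module
  have hJp : (Real.pi * Complex.I : ℂ) • J
      = (Real.pi * Complex.I : ℂ) • E + (-(2 * Real.pi * Complex.I) : ℂ) • p := by
    rw [hp]; module
  have hcomm : Commute ((Real.pi * Complex.I : ℂ) • E)
      ((-(2 * Real.pi * Complex.I) : ℂ) • p) := by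
    refine (Commute.smul_right ?_ _).smul_left _
    change E * p = p * E
    simp only [hp, mul_smul_comm, smul_mul_assoc, mul_sub, sub_mul, hE, hEJ, hJE]
  let _ : NormedAlgebra ℚ A := .restrictScalars ℚ ℂ A
  rw [hJp, NormedSpace.exp_add_of_commute hcomm, exp_smul_of_isIdempotentElem hE,
    exp_smul_of_isIdempotentElem hpp, Complex.exp_neg, Complex.exp_two_pi_mul_I,
    Complex.exp_pi_mul_I]
  simp only [inv_one, sub_self, zero_smul, add_zero, mul_one]
  module

end Exponential

variable {H : Type*} [NormedAddCommGroup H] [InnerProductSpace ℂ H] [CompleteSpace H]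

lemma isCompactOperator_exp_sub_one {T : H →L[ℂ] H} (hT : IsCompactOperator T) :
    IsCompactOperator (NormedSpace.exp T - 1 : H →L[ℂ] H) := by
  refine isCompactOperator_of_tendsto (hasSum_exp_sub_one T) (.of_forall fun s => ?_)
  refine (compactOperator (RingHom.id ℂ) H H).sum_mem fun n _ => Submodule.smul_mem _ _ ?_
  rw [pow_succ]
  exact hT.mul_left _

/-- The operators which, together with their adjoints, are compact and annihilated by `E` on both
sides. Including the adjoint avoids appealing to Schauder's theorem. -/
def compactAnnihilator (E : H →L[ℂ] H) : NonUnitalStarSubalgebra ℂ (H →L[ℂ] H) where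
  carrier := {T | IsCompactOperator T ∧ IsCompactOperator (star T : H →L[ℂ] H) ∧
    (T * E = 0 ∧ E * T = 0) ∧ (star T * E = 0 ∧ E * star T = 0)}
  add_mem' := by
    rintro S T ⟨h1, h2, ⟨h3, h4⟩, h5, h6⟩ ⟨h1', h2', ⟨h3', h4'⟩, h5', h6'⟩
    refine ⟨h1.add h1', by rw [star_add]; exact h2.add h2', ?_⟩
    simp [add_mul, mul_add, *]
  zero_mem' := by
    refine ⟨isCompactOperator_zero, by rw [star_zero]; exact isCompactOperator_zero, ?_⟩
    simp
  mul_mem' := by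
    rintro S T ⟨h1, h2, ⟨h3, h4⟩, h5, h6⟩ ⟨h1', h2', ⟨h3', h4'⟩, h5', h6'⟩
    refine ⟨h1.mul_right T, by rw [star_mul]; exact h2.mul_left _, ⟨?_, ?_⟩, ?_, ?_⟩
    · rw [mul_assoc, h3', mul_zero]
    · rw [← mul_assoc, h4, zero_mul]
    · rw [star_mul, mul_assoc, h5, mul_zero]
    · rw [star_mul, ← mul_assoc, h6', zero_mul]
  smul_mem' := by
    rintro c T ⟨h1, h2, ⟨h3, h4⟩, h5, h6⟩
    refine ⟨h1.smul c, by rw [star_smul]; exact h2.smul _, ?_⟩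
    simp [*]
  star_mem' := by
    rintro T ⟨h1, h2, h3, h4⟩
    exact ⟨h2, by rwa [star_star], h4, by rwa [star_star]⟩

lemma isClosed_compactAnnihilator (E : H →L[ℂ] H) :
    IsClosed (compactAnnihilator E : Set (H →L[ℂ] H)) := by
  have hc : IsClosed {T : H →L[ℂ] H | IsCompactOperator T} := isClosed_setOfPred_isCompactOperator
  refine hc.inter ((hc.preimage continuous_star).inter (.inter (.inter ?_ ?_) (.inter ?_ ?_)))
  all_goals exact isClosed_eq (by fun_prop) continuous_const

open Complex in
/-- The argument of a unitary `u` without the spectral value `-1`. If `u - 1` is compact and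
annihilated by `E`, then so is the argument, being a continuous function of `u - 1` vanishing at
`0`; and if a symmetry `R` conjugates `u` to its adjoint, then it conjugates the argument to its
negative. -/
lemma exists_compact_arg {u R E : H →L[ℂ] H} (hu : u ∈ unitary (H →L[ℂ] H))
    (hspec : -1 ∉ spectrum ℂ u) (hE : u - 1 ∈ compactAnnihilator E)
    (hR : IsSelfAdjoint R) (hRR : R * R = 1) (hRu : R * u * R = star u) :
    ∃ Y : H →L[ℂ] H, IsSelfAdjoint Y ∧ Y ∈ compactAnnihilator E ∧ ‖Y‖ ≤ Real.pi ∧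
      NormedSpace.exp (I • Y) = u ∧ R * Y = -(Y * R) := by
  have hlt := (Unitary.norm_sub_one_lt_two_iff hu).2 hspec
  have hslit := (Unitary.spectrum_subset_slitPlane_iff_norm_lt_two hu).2 hlt
  have hcont : ContinuousOn (fun z : ℂ => (arg z : ℂ)) (spectrum ℂ u) :=
    continuous_ofReal.comp_continuousOn (continuousOn_arg.mono hslit)
  have hnormal : IsStarNormal u := ⟨by
    rw [Commute, SemiconjBy, Unitary.star_mul_self_of_mem hu, Unitary.mul_star_self_of_mem hu]⟩
  set Y : H →L[ℂ] H := cfc (fun z : ℂ => (arg z : ℂ)) u with hY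
  refine ⟨Y, .cfc_arg u, ?_, Unitary.norm_argSelfAdjoint_le_pi ⟨u, hu⟩, ?_, ?_⟩
  · have hsub : cfc (fun z : ℂ => z - 1) u = u - 1 := by
      conv_rhs => rw [← cfc_id' ℂ u, ← cfc_one ℂ u, ← cfc_sub ..]
      rfl
    have hY' : Y = cfcₙ (fun z : ℂ => (arg (z + 1) : ℂ)) (u - 1) := by
      have hc : ContinuousOn (fun z : ℂ => (arg (z + 1) : ℂ)) (quasispectrum ℂ (u - 1)) := by
        refine continuous_ofReal.comp_continuousOn (continuousOn_arg.comp (by fun_prop) ?_)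
        intro z hz
        rw [quasispectrum_eq_spectrum_union_zero] at hz
        rcases hz with hz | hz
        · rw [← hsub, cfc_map_spectrum ..] at hz
          obtain ⟨w, hw, rfl⟩ := hz
          simpa using hslit hw
        · rw [Set.mem_singleton_iff.1 hz]
          simp
      have hc' : ContinuousOn (fun z : ℂ => (arg (z + 1) : ℂ))
          ((fun z : ℂ => z - 1) '' spectrum ℂ u) := by
        rw [← cfc_map_spectrum (R := ℂ) (fun z : ℂ => z - 1) u, hsub]
        exact hc.mono (spectrum_subset_quasispectrum ℂ _)
      rw [cfcₙ_eq_cfc hc (by simp), ← hsub, ← cfc_comp' _ _ _ hc']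
      simp [hY]
    rw [hY']
    exact NonUnitalStarAlgebra.elemental.le_of_mem (isClosed_compactAnnihilator E) hE
      (cfcₙ_mem_elemental _ _)
  · exact congr((($(expUnitary_argSelfAdjoint (u := ⟨u, hu⟩) hlt) :
      unitary (H →L[ℂ] H)) : H →L[ℂ] H))
  · have hRunit : R ∈ unitary (H →L[ℂ] H) := by
      rw [Unitary.mem_iff, hR.star_eq]; exact ⟨hRR, hRR⟩
    have hconj (T : H →L[ℂ] H) :
        Unitary.conjStarAlgAut ℂ (H →L[ℂ] H) ⟨R, hRunit⟩ T = R * T * R := by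
      simp [hR.star_eq]
    have hmap : R * Y * R = -Y := by
      have hnormal' : IsStarNormal (star u) := inferInstance
      have hcont' : ContinuousOn (fun z : ℂ => (arg z : ℂ)) (star '' spectrum ℂ u) := by
        refine continuous_ofReal.comp_continuousOn (continuousOn_arg.mono ?_)
        rintro _ ⟨z, hz, rfl⟩
        simpa [mem_slitPlane_iff] using hslit hz
      have hfun : ⇑(Unitary.conjStarAlgAut ℂ (H →L[ℂ] H) ⟨R, hRunit⟩) = fun T => R * T * R :=
        funext hconj
      rw [← hconj, hY, StarAlgHomClass.map_cfc (Unitary.conjStarAlgAut ℂ (H →L[ℂ] H) ⟨R, hRunit⟩)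
        (fun z : ℂ => (arg z : ℂ)) u hcont ?_ hnormal ?_, hconj, hRu,
        ← cfc_comp_star _ _ hcont', ← cfc_neg]
      · refine cfc_congr fun z hz => ?_
        have : arg z ≠ Real.pi := (mem_slitPlane_iff_arg.1 (hslit hz)).1
        simp [arg_conj, this]
      · rw [hfun]; fun_prop
      · rwa [hconj, hRu]
    calc R * Y = R * Y * R * R := by rw [mul_assoc _ R R, hRR, mul_one]
      _ = -(Y * R) := by rw [hmap, neg_mul]

end Argument

/-! ### The logarithm of a product of two symmetries -/

section Logarithm

variable {H : Type*} [NormedAddCommGroup H] [InnerProductSpace ℂ H] [CompleteSpace H]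

/-- A partial isometry between finite-dimensional subspaces of equal dimension. -/
lemma exists_partialIsometry {N M : Submodule ℂ H} [FiniteDimensional ℂ N]
    [FiniteDimensional ℂ M] (h : Module.finrank ℂ N = Module.finrank ℂ M) :
    ∃ V : H →L[ℂ] H, star V * V = N.starProjection ∧ V * star V = M.starProjection := by
  let φ : N ≃ₗᵢ[ℂ] M :=
    (stdOrthonormalBasis ℂ N).equiv (stdOrthonormalBasis ℂ M) (finCongr h)
  let φ' : N →L[ℂ] M := φ.toContinuousLinearEquiv
  let V : H →L[ℂ] H := M.subtypeL ∘L φ' ∘L N.orthogonalProjectionOnto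
  have hstar : star V = N.subtypeL ∘L (φ.symm.toContinuousLinearEquiv : M →L[ℂ] N) ∘L
      M.orthogonalProjectionOnto := by
    rw [ContinuousLinearMap.star_eq_adjoint]
    simp only [V, ContinuousLinearMap.adjoint_comp, Submodule.adjoint_subtypeL,
      Submodule.adjoint_orthogonalProjectionOnto]
    have : ContinuousLinearMap.adjoint φ' = (φ.symm.toContinuousLinearEquiv : M →L[ℂ] N) :=
      φ.adjoint_eq_symm
    rw [this]
    rfl
  refine ⟨V, ?_, ?_⟩
  · ext x
    simp [hstar, V, φ']
  · ext x
    simp [hstar, V, φ']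

/-- An orthogonal sum of operators is bounded by the larger of the two norms. -/
lemma norm_add_le_of_orthogonal {E S T : H →L[ℂ] H} {c : ℝ} (hE : IsStarProjection E)
    (hS : S * E = 0) (hS' : E * S = 0) (hT : T * E = T) (hT' : E * T = T) (hc : 0 ≤ c)
    (hSc : ‖S‖ ≤ c) (hTc : ‖T‖ ≤ c) : ‖S + T‖ ≤ c := by
  refine ContinuousLinearMap.opNorm_le_bound _ hc fun x => ?_
  have pyth (y z : H) (hy : E y = 0) (hz : E z = z) : ‖y + z‖ ^ 2 = ‖y‖ ^ 2 + ‖z‖ ^ 2 := by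
    have : inner ℂ y z = 0 := by rw [← hz, ← inner_apply_left hE, hy, inner_zero_left]
    simpa only [← sq] using norm_add_sq_eq_norm_sq_add_norm_sq_of_inner_eq_zero y z this
  have hEE (y : H) : E (E y) = E y := congr($(hE.isIdempotentElem.eq) y)
  have hST : (S + T) x = S (x - E x) + T (E x) := by
    have h1 : S (E x) = 0 := congr($hS x)
    have h2 : T (E x) = T x := congr($hT x)
    rw [map_sub, h1, h2, sub_zero]
    rfl
  have h1 := pyth (x - E x) (E x) (by rw [map_sub, hEE, sub_self]) (hEE x)
  rw [sub_add_cancel] at h1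
  have h2 := pyth (S (x - E x)) (T (E x)) congr($hS' (x - E x)) congr($hT' (E x))
  have h3 := S.le_of_opNorm_le hSc (x - E x)
  have h4 := T.le_of_opNorm_le hTc (E x)
  refine le_of_sq_le_sq ?_ (by positivity)
  rw [hST, h2, mul_pow, h1, mul_add, ← mul_pow, ← mul_pow]
  gcongr

/-- A partial isometry `V` between orthogonal projections `A` and `B` gives a self-adjoint
operator exchanging their ranges, which anticommutes with every symmetry acting as `1` on the range
of `A` and as `-1` on that of `B`. -/
lemma exists_exchange {A B R V : H →L[ℂ] H} (hA : IsStarProjection A) (hB : IsStarProjection B)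
    (hAB : A * B = 0) (hR : IsSelfAdjoint R) (hRA : R * A = A) (hRB : R * B = -B)
    (hVV : star V * V = A) (hVV' : V * star V = B) :
    ∃ J : H →L[ℂ] H, IsSelfAdjoint J ∧ J * J = A + B ∧ (A + B) * J = J ∧ J * (A + B) = J ∧
      R * J = -(J * R) := by
  have hAA := hA.isIdempotentElem.eq
  have hAs := hA.isSelfAdjoint.star_eq
  have hBs := hB.isSelfAdjoint.star_eq
  have hBA : B * A = 0 := by simpa [hAs, hBs] using congr(star $hAB)
  have hVA : V * A = V := by
    have h0 : star (V * (1 - A)) * (V * (1 - A)) = 0 := by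
      rw [star_mul, mul_assoc, ← mul_assoc (star V), hVV, mul_sub, mul_one, hAA, sub_self,
        mul_zero]
    have h1 := CStarRing.star_mul_self_eq_zero_iff _ |>.1 h0
    rw [mul_sub, mul_one, sub_eq_zero] at h1
    exact h1.symm
  have hBV : B * V = V := by rw [← hVV', mul_assoc, hVV, hVA]
  have hAV : A * V = 0 := by rw [← hBV, ← mul_assoc, hAB, zero_mul]
  have hVB : V * B = 0 := by rw [← hVA, mul_assoc, hAB, mul_zero]
  have hRV : R * V = -V := by rw [← hBV, ← mul_assoc, hRB, neg_mul]
  have hAR : A * R = A := by simpa [hAs, hR.star_eq] using congr(star $hRA)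
  have hVR : V * R = V := by rw [← hVA, mul_assoc, hAR]
  have hAV' : A * star V = star V := by simpa [hAs] using congr(star $hVA)
  have hVB' : star V * B = star V := by simpa [hBs] using congr(star $hBV)
  have hVA' : star V * A = 0 := by simpa [hAs] using congr(star $hAV)
  have hBV' : B * star V = 0 := by simpa [hBs] using congr(star $hVB)
  have hRV' : R * star V = star V := by simpa [hR.star_eq] using congr(star $hVR)
  have hVR' : star V * R = -star V := by simpa [hR.star_eq] using congr(star $hRV)
  have hVV0 : V * V = 0 := by rw [← hBV, ← mul_assoc, mul_assoc B, hVB, mul_zero, zero_mul]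
  have hVV0' : star V * star V = 0 := by rw [← star_mul, hVV0, star_zero]
  refine ⟨Complex.I • (star V - V), ?_, ?_, ?_, ?_, ?_⟩
  · rw [IsSelfAdjoint, star_smul, star_sub, star_star, Complex.star_def, Complex.conj_I, neg_smul,
      ← smul_neg, neg_sub]
  · rw [smul_mul_smul_comm, Complex.I_mul_I, neg_one_smul, sub_mul, mul_sub, mul_sub, hVV, hVV',
      hVV0, hVV0']
    abel
  · rw [mul_smul_comm, add_mul, mul_sub, mul_sub, hAV, hAV', hBV, hBV', sub_zero, zero_sub,
      ← sub_eq_add_neg]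
  · rw [smul_mul_assoc, mul_add, sub_mul, sub_mul, hVA, hVA', hVB, hVB', sub_zero, zero_sub,
      neg_add_eq_sub]
  · rw [mul_smul_comm, smul_mul_assoc, mul_sub, sub_mul, hRV, hRV', hVR, hVR', ← smul_neg]
    congr 1
    abel

/-- The eigenspace of `(2 Q - 1) (2 P - 1)` for the eigenvalue `-1` lies in the sum of
`ran P ∩ ker Q` and `ran Q ∩ ker P`. -/
lemma mem_rangeInfKer_of_symmetry_mul_symmetry_apply {P Q : H →L[ℂ] H} (hP : IsStarProjection P)
    (hQ : IsStarProjection Q) {x : H} (hx : ((2 * Q - 1) * (2 * P - 1)) x = -x) :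
    P x ∈ rangeInfKer P Q ∧ Q x ∈ rangeInfKer Q P ∧ P x + Q x = x := by
  have hPP (y : H) : P (P y) = P y := congr($(hP.isIdempotentElem.eq) y)
  have hQQ (y : H) : Q (Q y) = Q y := congr($(hQ.isIdempotentElem.eq) y)
  have hsum : P x + Q x = x := by
    have h1 : Q (P x + P x - x) + Q (P x + P x - x) - (P x + P x - x) = -x := by
      simpa [two_mul] using hx
    have h2 := congr(Q $h1)
    simp only [map_add, map_sub, map_neg, hQQ] at h1 h2
    have h3 : (2 : ℂ) • (P x + Q x) = (2 : ℂ) • x := by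
      rw [← sub_eq_zero] at h1 h2 ⊢
      linear_combination (norm := module) (2 : ℂ) • h2 - h1
    exact smul_right_injective H (two_ne_zero (α := ℂ)) h3
  have hPQx : P (Q x) = 0 := by
    have := congr(P $hsum); rwa [map_add, hPP, add_eq_left] at this
  have hQPx : Q (P x) = 0 := by
    have := congr(Q $hsum); rwa [map_add, hQQ, add_eq_right] at this
  exact ⟨mem_rangeInfKer.2 ⟨hPP x, hQPx⟩, mem_rangeInfKer.2 ⟨hQQ x, hPQx⟩, hsum⟩

/-- If two symmetries `R` and `S` are opposite to each other on the range of `E`, then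
`S * R + 2 * E` is the unitary which agrees with `S * R` off that range and with `1` on it. -/
lemma symmetry_mul_symmetry_add {R S E : H →L[ℂ] H} (hRs : IsSelfAdjoint R)
    (hSs : IsSelfAdjoint S) (hRR : R * R = 1) (hSS : S * S = 1) (hE : IsStarProjection E)
    (hER : E * R = R * E) (hSE : S * E = -(R * E)) :
    star (S * R + 2 * E) = R * S + 2 * E ∧ S * R + 2 * E ∈ unitary (H →L[ℂ] H) ∧
      (S * R + 2 * E) * E = E ∧ E * (S * R + 2 * E) = E ∧
      R * (S * R + 2 * E) * R = star (S * R + 2 * E) := by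
  have hEE := hE.isIdempotentElem.eq
  have hES : E * S = -(R * E) := by
    simpa [hSs.star_eq, hRs.star_eq, hE.isSelfAdjoint.star_eq, hER] using congr(star $hSE)
  have hSRE : S * R * E = -E := by
    rw [mul_assoc, ← neg_eq_iff_eq_neg.2 hSE, mul_neg, ← mul_assoc, hSS, one_mul]
  have hESR : E * (S * R) = -E := by
    rw [← mul_assoc, hES, ← hER, neg_mul, mul_assoc, hRR, mul_one]
  have hRSE : R * S * E = -E := by
    rw [mul_assoc, hSE, mul_neg, ← mul_assoc, hRR, one_mul]
  have hERS : E * (R * S) = -E := by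
    rw [← mul_assoc, hER, mul_assoc, hES, mul_neg, ← mul_assoc, hRR, one_mul]
  have hus : star (S * R + 2 * E) = R * S + 2 * E := by
    simp [hRs.star_eq, hSs.star_eq, hE.isSelfAdjoint.star_eq, (Commute.ofNat_left 2 E).eq]
  refine ⟨hus, ?_, ?_, ?_, ?_⟩
  · have h1 : R * S * (S * R) = 1 := by rw [mul_assoc, ← mul_assoc S, hSS, one_mul, hRR]
    have h2 : S * R * (R * S) = 1 := by rw [mul_assoc, ← mul_assoc R, hRR, one_mul, hSS]
    rw [Unitary.mem_iff, hus]
    simp only [two_mul, mul_add, add_mul, h1, h2, hRSE, hESR, hSRE, hERS, hEE]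
    constructor <;> abel
  · simp only [two_mul, add_mul, hSRE, hEE]; abel
  · simp only [two_mul, mul_add, hESR, hEE]; abel
  · have h1 : R * (S * R) * R = R * S := by rw [← mul_assoc, mul_assoc _ R R, hRR, mul_one]
    have h2 : R * E * R = E := by rw [← hER, mul_assoc, hRR, mul_one]
    rw [hus]
    simp only [two_mul, mul_add, add_mul, h1, h2]

/-- Off the range of `E` the logarithm is `Y`, with exponential `exp (i Y)`; on it the logarithm is
a multiple of the symmetry `J`, with exponential `-1`. -/
lemma exists_log_of_orthogonal {E R Y J : H →L[ℂ] H} (hE : IsStarProjection E)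
    (hYs : IsSelfAdjoint Y) (hYc : IsCompactOperator Y) (hYE : Y * E = 0) (hEY : E * Y = 0)
    (hYn : ‖Y‖ ≤ Real.pi) (hYR : R * Y = -(Y * R)) (hJs : IsSelfAdjoint J)
    (hJc : IsCompactOperator J) (hJJ : J * J = E) (hEJ : E * J = J) (hJE : J * E = J)
    (hJR : R * J = -(J * R)) :
    ∃ X : H →L[ℂ] H, IsSelfAdjoint X ∧ IsCompactOperator X ∧ ‖X‖ ≤ Real.pi / 2 ∧
      R * X = -(X * R) ∧
      NormedSpace.exp ((2 * Complex.I) • X)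
        = NormedSpace.exp (Complex.I • Y) * (1 - (2 : ℂ) • E) := by
  have hJn : ‖J‖ ≤ 1 := by
    have h1 : ‖J‖ * ‖J‖ = ‖E‖ := by rw [← CStarRing.norm_star_mul_self, hJs.star_eq, hJJ]
    have := hE.norm_le
    nlinarith [norm_nonneg J]
  have hYJ : Y * J = 0 := by rw [← hEJ, ← mul_assoc, hYE, zero_mul]
  have hJY : J * Y = 0 := by rw [← hJE, mul_assoc, hEY, mul_zero]
  have hpi := Real.pi_pos
  have hhalf : star (1 / 2 : ℂ) = 1 / 2 := by simp
  have hpi2 : star (Real.pi / 2 : ℂ) = Real.pi / 2 := by simp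
  have hhalf_norm : ‖(1 / 2 : ℂ)‖ = 1 / 2 := by norm_num
  have hpi2_norm : ‖(Real.pi / 2 : ℂ)‖ = Real.pi / 2 := by simp [abs_of_pos hpi]
  refine ⟨(1 / 2 : ℂ) • Y + (Real.pi / 2 : ℂ) • J, ?_, (hYc.smul _).add (hJc.smul _), ?_, ?_, ?_⟩
  · rw [IsSelfAdjoint, star_add, star_smul, star_smul, hJs.star_eq, hYs.star_eq, hhalf, hpi2]
  · refine norm_add_le_of_orthogonal hE ?_ ?_ ?_ ?_ (by positivity) ?_ ?_
    · rw [smul_mul_assoc, hYE, smul_zero]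
    · rw [mul_smul_comm, hEY, smul_zero]
    · rw [smul_mul_assoc, hJE]
    · rw [mul_smul_comm, hEJ]
    · rw [norm_smul (1 / 2 : ℂ) Y, hhalf_norm]
      linarith
    · rw [norm_smul (Real.pi / 2 : ℂ) J, hpi2_norm]
      nlinarith
  · rw [mul_add, add_mul, mul_smul_comm, mul_smul_comm, hYR, hJR, smul_mul_assoc, smul_mul_assoc,
      smul_neg, smul_neg, neg_add]
  · have hsplit : (2 * Complex.I) • ((1 / 2 : ℂ) • Y + (Real.pi / 2 : ℂ) • J)
        = Complex.I • Y + (Real.pi * Complex.I : ℂ) • J := by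
      rw [smul_add, smul_smul, smul_smul]
      congr 2 <;> ring
    have hcomm : Commute (Complex.I • Y) ((Real.pi * Complex.I : ℂ) • J) := by
      rw [Commute, SemiconjBy, smul_mul_smul_comm, smul_mul_smul_comm, hYJ, hJY, smul_zero,
        smul_zero]
    let _ : NormedAlgebra ℚ (H →L[ℂ] H) := .restrictScalars ℚ ℂ _
    rw [hsplit, NormedSpace.exp_add_of_commute hcomm,
      exp_pi_mul_I_smul hJJ hE.isIdempotentElem.eq hEJ hJE]

lemma isSelfAdjoint_two_mul_sub_one {P : H →L[ℂ] H} (hP : IsStarProjection P) :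
    IsSelfAdjoint (2 * P - 1) := by
  simp [IsSelfAdjoint, hP.isSelfAdjoint.star_eq, (Commute.ofNat_left 2 P).eq]

lemma two_mul_sub_one_mul_self {P : H →L[ℂ] H} (hP : IsStarProjection P) :
    (2 * P - 1) * (2 * P - 1) = 1 := by
  simp only [two_mul, mul_sub, sub_mul, mul_add, add_mul, hP.isIdempotentElem.eq, mul_one, one_mul]
  abel

/-- The logarithm of `(2 Q - 1) (2 P - 1)` with values in the operators anticommuting with
`2 P - 1`. On the orthogonal complement of `ran P ∩ ker Q ⊕ ran Q ∩ ker P` it is given by the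
functional calculus, since there `-1` is not a spectral value; on that sum, where
`(2 Q - 1) (2 P - 1) = -1`, it exchanges the two summands. -/
lemma exists_compact_log {P Q : H →L[ℂ] H} (hP : IsStarProjection P)
    (hQ : IsStarProjection Q) (hc : IsCompactOperator (P - Q : H →L[ℂ] H))
    (hrank : Module.finrank ℂ (rangeInfKer P Q) = Module.finrank ℂ (rangeInfKer Q P)) :
    ∃ X : H →L[ℂ] H, IsSelfAdjoint X ∧ IsCompactOperator X ∧ ‖X‖ ≤ Real.pi / 2 ∧
      (2 * P - 1) * X = -(X * (2 * P - 1)) ∧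
      NormedSpace.exp ((2 * Complex.I) • X) = (2 * Q - 1) * (2 * P - 1) := by
  have hc' : IsCompactOperator (Q - P : H →L[ℂ] H) := by
    rw [← neg_sub P Q]; exact hc.neg
  have := finiteDimensional_rangeInfKer hc
  have := finiteDimensional_rangeInfKer hc'
  obtain ⟨V, hVV, hVV'⟩ := exists_partialIsometry hrank
  set N := rangeInfKer P Q
  set M := rangeInfKer Q P
  have hPs := hP.isSelfAdjoint.star_eq
  have hQs := hQ.isSelfAdjoint.star_eq
  set A := N.starProjection
  set B := M.starProjection
  have hAp : IsStarProjection A := isStarProjection_starProjection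
  have hBp : IsStarProjection B := isStarProjection_starProjection
  have hAs := hAp.isSelfAdjoint.star_eq
  have hBs := hBp.isSelfAdjoint.star_eq
  have hAA := hAp.isIdempotentElem.eq
  have hBB := hBp.isIdempotentElem.eq
  have hPA : P * A = A := by
    ext x; exact (mem_rangeInfKer.1 (N.starProjection_apply_mem x)).1
  have hQA : Q * A = 0 := by
    ext x; exact (mem_rangeInfKer.1 (N.starProjection_apply_mem x)).2
  have hQB : Q * B = B := by
    ext x; exact (mem_rangeInfKer.1 (M.starProjection_apply_mem x)).1
  have hPB : P * B = 0 := by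
    ext x; exact (mem_rangeInfKer.1 (M.starProjection_apply_mem x)).2
  have hAP : A * P = A := by simpa [hAs, hPs] using congr(star $hPA)
  have hAQ : A * Q = 0 := by simpa [hAs, hQs] using congr(star $hQA)
  have hBQ : B * Q = B := by simpa [hBs, hQs] using congr(star $hQB)
  have hBP : B * P = 0 := by simpa [hBs, hPs] using congr(star $hPB)
  have hAB : A * B = 0 := by rw [← hAP, mul_assoc, hPB, mul_zero]
  have hBA : B * A = 0 := by rw [← hBQ, mul_assoc, hQA, mul_zero]
  -- The projection onto the eigenspace of `S * R` for `-1`.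
  set E := A + B with hE
  have hEp : IsStarProjection E := hAp.add hBp hAB
  have hEs := hEp.isSelfAdjoint.star_eq
  set R := 2 * P - 1 with hR
  set S := 2 * Q - 1 with hS
  have hRs : IsSelfAdjoint R := isSelfAdjoint_two_mul_sub_one hP
  have hSs : IsSelfAdjoint S := isSelfAdjoint_two_mul_sub_one hQ
  have hRR : R * R = 1 := two_mul_sub_one_mul_self hP
  have hSS : S * S = 1 := two_mul_sub_one_mul_self hQ
  have hRE : R * E = A - B := by
    simp only [hR, hE, two_mul, sub_mul, mul_add, add_mul, hPA, hPB, one_mul]; abel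
  have hER : E * R = A - B := by
    simp only [hR, hE, two_mul, mul_sub, mul_add, add_mul, hAP, hBP, mul_one]; abel
  have hSE : S * E = B - A := by
    simp only [hS, hE, two_mul, sub_mul, mul_add, add_mul, hQA, hQB, one_mul]; abel
  obtain ⟨hus, huU, huE, hEu, hRu⟩ := symmetry_mul_symmetry_add hRs hSs hRR hSS hEp
    (hER.trans hRE.symm) (by rw [hSE, hRE, neg_sub])
  -- `u` agrees with `S * R` off the range of `E` and is `1` on it, which removes the eigenvalue `-1`.
  set u := S * R + 2 * E with hu
  have hAc : IsCompactOperator A := by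
    have : A = (P - Q) * A := by rw [sub_mul, hPA, hQA, sub_zero]
    rw [this]; exact hc.mul_right A
  have hBc : IsCompactOperator B := by
    have : B = (Q - P) * B := by rw [sub_mul, hQB, hPB, sub_zero]
    rw [this]; exact hc'.mul_right B
  have hEc : IsCompactOperator E := hAc.add hBc
  have hu1 : u - 1 = (2 : ℂ) • ((Q - P) * R + E) := by
    have : S * R = 1 + 2 * (Q - P) * R := by
      have : S = R + 2 * (Q - P) := by rw [hS, hR]; noncomm_ring
      rw [this, add_mul, hRR]
    rw [hu, this, two_smul]; noncomm_ring
  have hu1s : star u - 1 = (2 : ℂ) • (R * (Q - P) + E) := by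
    have : R * S = 1 + R * (2 * (Q - P)) := by
      have : S = R + 2 * (Q - P) := by rw [hS, hR]; noncomm_ring
      rw [this, mul_add, hRR]
    rw [hus, this, two_smul]; noncomm_ring
  have hmem : u - 1 ∈ compactAnnihilator E := by
    refine ⟨?_, ?_, ⟨?_, ?_⟩, ?_, ?_⟩
    · rw [hu1]; exact ((hc'.mul_right R).add hEc).smul _
    · rw [star_sub, star_one, hu1s]; exact ((hc'.mul_left R).add hEc).smul _
    · rw [sub_mul, huE, one_mul, sub_self]
    · rw [mul_sub, hEu, mul_one, sub_self]
    · rw [← hEs, ← star_mul, mul_sub, hEu, mul_one, sub_self, star_zero]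
    · rw [← hEs, ← star_mul, sub_mul, huE, one_mul, sub_self, star_zero]
  have hspec : -1 ∉ spectrum ℂ u := by
    -- As `u - 1` is compact, `-1` could only be an eigenvalue of `u`. An eigenvector would be killed by
    -- `E`, hence be an eigenvector of `S * R`, and so lie in the range of `E`.
    intro h
    have h2 : (-2 : ℂ) ∈ spectrum ℂ (u - 1) := by
      rw [spectrum.mem_iff] at h ⊢
      have : algebraMap ℂ (H →L[ℂ] H) (-2) - (u - 1) = algebraMap ℂ (H →L[ℂ] H) (-1) - u := by
        rw [show (-2 : ℂ) = -1 - 1 by norm_num, map_sub, map_one]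
        abel
      rwa [this]
    obtain ⟨x, hx, hx0⟩ :=
      ((IsCompactOperator.hasEigenvalue_iff_mem_spectrum hmem.1 (by norm_num)).2
        h2).exists_hasEigenvector
    refine hx0 ?_
    have hux : u x = -x := by
      have h3 := Module.End.mem_eigenspace_iff.1 hx
      have h4 : u x - x = (-2 : ℂ) • x := h3
      rw [sub_eq_iff_eq_add.1 h4]; module
    have hEx : E x = 0 := by
      have h3 : E (u x) = E x := congr($hEu x)
      rw [hux, map_neg] at h3
      have h4 : (2 : ℂ) • E x = 0 := by
        rw [two_smul]; nth_rw 1 [← h3]; exact neg_add_cancel _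
      exact (smul_eq_zero.1 h4).resolve_left two_ne_zero
    have hSRx : (S * R) x = -x := by
      have h3 : (S * R) x + (2 * E) x = u x := rfl
      rw [hux] at h3
      simpa [two_mul, hEx] using h3
    obtain ⟨hPxN, hQxM, hsum⟩ := mem_rangeInfKer_of_symmetry_mul_symmetry_apply hP hQ hSRx
    have hAx : A x = 0 := by
      have h3 : A (E x) = A x := by
        have : A * E = A := by rw [hE, mul_add, hAA, hAB, add_zero]
        exact congr($this x)
      rw [← h3, hEx, map_zero]
    have hBx : B x = 0 := by
      have h3 : B (E x) = B x := by
        have : B * E = B := by rw [hE, mul_add, hBB, hBA, zero_add]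
        exact congr($this x)
      rw [← h3, hEx, map_zero]
    have hPx : P x = 0 := by
      have h3 : A (P x) = A x := congr($hAP x)
      rw [← hAx, ← h3]
      exact (Submodule.starProjection_eq_self_iff.2 hPxN).symm
    have hQx : Q x = 0 := by
      have h3 : B (Q x) = B x := congr($hBQ x)
      rw [← hBx, ← h3]
      exact (Submodule.starProjection_eq_self_iff.2 hQxM).symm
    rw [← hsum, hPx, hQx, add_zero]
  obtain ⟨Y, hYs, ⟨hYc, -, ⟨hYE, hEY⟩, -⟩, hYn, hYexp, hYR⟩ :=
    exists_compact_arg huU hspec hmem hRs hRR hRu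
  -- On the range of `E` the logarithm has to anticommute with `R`, which is `1` on the range of `A`
  -- and `-1` on that of `B`.
  have hRA : R * A = A := by
    rw [hR, sub_mul, mul_assoc, hPA, two_mul, one_mul, add_sub_cancel_right]
  have hRB : R * B = -B := by
    rw [hR, sub_mul, mul_assoc, hPB, mul_zero, one_mul, zero_sub]
  obtain ⟨J, hJs, hJJ, hEJ, hJE, hJR⟩ := exists_exchange hAp hBp hAB hRs hRA hRB hVV hVV'
  have hJc : IsCompactOperator J := by rw [← hEJ]; exact hEc.mul_right J
  obtain ⟨X, hXs, hXc, hXn, hXR, hXexp⟩ :=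
    exists_log_of_orthogonal hEp hYs hYc hYE hEY hYn hYR hJs hJc hJJ hEJ hJE hJR
  refine ⟨X, hXs, hXc, hXn, hXR, ?_⟩
  rw [hXexp, hYexp, mul_sub, mul_one, mul_smul_comm, huE, hu, two_smul, two_mul]
  abel

end Logarithm

/-! ### Lengths of curves on a sphere -/

open Set Filter Topology in
/-- The length of a piecewise differentiable curve on a unit sphere is at least the angle between
its endpoints. As `arccos` is not differentiable at `±1`, the proof bounds the variation of
`arccos (r * ⟪f c, f t⟫)` for `r < 1` and lets `r` tend to `1`. -/
lemma arccos_inner_le_lintegral_enorm_deriv {E : Type*} [NormedAddCommGroup E]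
    [InnerProductSpace ℝ E] {f : ℝ → E} {c d : ℝ} (hcd : c ≤ d) (hf : ContinuousOn f (Icc c d))
    {s : Set ℝ} (hs : s.Countable) (hdiff : ∀ t ∈ Ioo c d, t ∉ s → DifferentiableAt ℝ f t)
    (hnorm : ∀ t ∈ Icc c d, ‖f t‖ = 1) :
    ENNReal.ofReal (Real.arccos (inner ℝ (f c) (f d))) ≤ ∫⁻ t in Icc c d, ‖deriv f t‖ₑ := by
  set v := f c
  have hv : ‖v‖ = 1 := hnorm c (left_mem_Icc.2 hcd)
  let h (r t : ℝ) : ℝ := Real.arccos (r * inner ℝ v (f t))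
  have hderiv (r : ℝ) (hr : r ∈ Ioo (0 : ℝ) 1) (t : ℝ) (ht : t ∈ Ioo c d) (hts : t ∉ s) :
      DifferentiableAt ℝ (h r) t ∧ ‖deriv (h r) t‖ ≤ ‖deriv f t‖ := by
    have hft := (hdiff t ht hts).hasDerivAt
    set w := deriv f t
    set g : ℝ := inner ℝ v (f t) with hg
    have hn : ‖f t‖ = 1 := hnorm t (Ioo_subset_Icc_self ht)
    -- The velocity of a curve on the sphere is tangent, so only the component of `v` orthogonal to
    -- `f t` contributes to the derivative of `⟪v, f t⟫`.
    have horth : inner ℝ (f t) w = 0 := by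
      have h1 : HasDerivAt (fun t => ‖f t‖ ^ 2) (2 * inner ℝ (f t) w) t := hft.norm_sq
      have h2 : HasDerivAt (fun t => ‖f t‖ ^ 2) 0 t := by
        refine (hasDerivAt_const t (1 : ℝ)).congr_of_eventuallyEq ?_
        filter_upwards [Ioo_mem_nhds ht.1 ht.2] with u hu
        rw [hnorm u (Ioo_subset_Icc_self hu), one_pow]
      simpa using h1.unique h2
    have hw : inner ℝ v w = inner ℝ (v - g • f t) w := by
      rw [inner_sub_left, inner_smul_left, horth, mul_zero, sub_zero]
    have hsq : ‖v - g • f t‖ ^ 2 = 1 - g ^ 2 := by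
      rw [norm_sub_sq_real, inner_smul_right, norm_smul, hv, hn, ← hg, mul_one,
        Real.norm_eq_abs, sq_abs]
      ring
    have hCS : inner ℝ v w ^ 2 ≤ (1 - g ^ 2) * ‖w‖ ^ 2 := by
      rw [hw, ← hsq, ← mul_pow, ← sq_abs]
      gcongr
      exact abs_real_inner_le_norm _ _
    have hg1 : g ^ 2 ≤ 1 := by nlinarith [sq_nonneg ‖v - g • f t‖]
    have hpos : 0 < 1 - (r * g) ^ 2 := by
      nlinarith [hr.1, hr.2, mul_pow r g 2, sq_nonneg g]
    have hd : HasDerivAt (h r) (-(1 / √(1 - (r * g) ^ 2)) * (r * inner ℝ v w)) t := by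
      have hin : HasDerivAt (fun t => r * inner ℝ v (f t)) (r * inner ℝ v w) t := by
        simpa using ((hasDerivAt_const t v).inner ℝ hft).const_mul r
      refine (Real.hasDerivAt_arccos ?_ ?_).comp t hin
      all_goals
        intro h0
        change r * g = _ at h0
        rw [h0] at hpos
        norm_num at hpos
    refine ⟨hd.differentiableAt, ?_⟩
    have hroot := Real.sqrt_pos.2 hpos
    rw [hd.deriv, norm_mul, norm_neg, norm_div, norm_one, Real.norm_of_nonneg hroot.le,
      one_div_mul_eq_div, div_le_iff₀ hroot, Real.norm_eq_abs]
    refine abs_le_of_sq_le_sq ?_ (by positivity)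
    rw [mul_pow, mul_pow, Real.sq_sqrt hpos.le]
    calc r ^ 2 * inner ℝ v w ^ 2 ≤ r ^ 2 * ((1 - g ^ 2) * ‖w‖ ^ 2) := by gcongr
      _ ≤ ‖w‖ ^ 2 * (1 - (r * g) ^ 2) := by
        nlinarith [hr.1, hr.2, sq_nonneg ‖w‖, mul_nonneg (sq_nonneg ‖w‖)
          (by nlinarith [hr.1, hr.2] : (0 : ℝ) ≤ 1 - r ^ 2)]
  have hbound (r : ℝ) (hr : r ∈ Ioo (0 : ℝ) 1) :
      ENNReal.ofReal (h r d - h r c) ≤ ∫⁻ t in Icc c d, ‖deriv f t‖ₑ := by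
    -- Finiteness of the length makes the derivative of `h r` integrable, so that the fundamental
    -- theorem of calculus applies.
    by_cases htop : ∫⁻ t in Icc c d, ‖deriv f t‖ₑ = ∞
    · simp [htop]
    have hcont : ContinuousOn (h r) (Icc c d) :=
      Real.continuous_arccos.comp_continuousOn ((continuousOn_const.inner hf).const_mul r)
    have hle : ∫⁻ t in Ioc c d, ‖deriv (h r) t‖ₑ ≤ ∫⁻ t in Icc c d, ‖deriv f t‖ₑ := by
      rw [← restrict_Ioo_eq_restrict_Ioc, ← restrict_Ioo_eq_restrict_Icc]
      refine lintegral_mono_ae ?_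
      filter_upwards [ae_restrict_mem measurableSet_Ioo,
        ae_restrict_of_ae (hs.ae_notMem volume)] with t ht hts
      rw [enorm_le_iff_norm_le]
      exact (hderiv r hr t ht hts).2
    have hint : IntegrableOn (deriv (h r)) (Ioc c d) :=
      ⟨(measurable_deriv (h r)).aestronglyMeasurable, hle.trans_lt (lt_top_iff_ne_top.2 htop)⟩
    have hFTC := integral_eq_of_hasDerivAt_off_countable_of_le (h r) (deriv (h r)) hcd hs hcont
      (fun t ht => (hderiv r hr t ht.1 ht.2).1.hasDerivAt)
      ((intervalIntegrable_iff_integrableOn_Ioc_of_le hcd).2 hint)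
    rw [← hFTC, intervalIntegral.integral_of_le hcd]
    refine (Real.ofReal_le_enorm _).trans ?_
    exact (enorm_integral_le_lintegral_enorm _).trans hle
  have hlim : Tendsto (fun r : ℝ => ENNReal.ofReal (h r d - h r c)) (𝓝[<] 1)
      (𝓝 (ENNReal.ofReal (h 1 d - h 1 c))) := by
    refine ((ENNReal.continuous_ofReal.comp ?_).tendsto 1).mono_left nhdsWithin_le_nhds
    simp only [h]
    fun_prop
  have hfin : h 1 d - h 1 c = Real.arccos (inner ℝ v (f d)) := by
    have : (inner ℝ v (f c) : ℝ) = 1 := by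
      change inner ℝ v v = 1
      rw [real_inner_self_eq_norm_sq, hv, one_pow]
    simp [h, this]
  rw [hfin] at hlim
  exact le_of_tendsto hlim
    (eventually_of_mem (Ioo_mem_nhdsLT zero_lt_one) hbound)

/-! ### The lower bound for the length of a curve of projections -/

section Length

variable {H : Type*} [NormedAddCommGroup H] [InnerProductSpace ℂ H] [CompleteSpace H]

lemma exp_apply_of_apply_eq_smul {T : H →L[ℂ] H} {c : ℂ} {x : H} (h : T x = c • x) :
    NormedSpace.exp T x = Complex.exp c • x := by
  have hpow (n : ℕ) : (T ^ n) x = c ^ n • x := by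
    induction n with
    | zero => simp
    | succ n ih => rw [pow_succ', mul_apply_eq_comp, ih, map_smul, h, smul_smul, pow_succ]
  have h1 := (ContinuousLinearMap.apply ℂ H x).hasSum
    (NormedSpace.exp_series_hasSum_exp' (𝕂 := ℂ) T)
  have h2 := (NormedSpace.exp_series_hasSum_exp' (𝕂 := ℂ) c).smul_const x
  rw [← Complex.exp_eq_exp_ℂ] at h2
  refine h1.unique ?_
  convert h2 using 2 with n
  simp [hpow, smul_smul]

lemma norm_two_mul_sub_one_apply {P : H →L[ℂ] H} (hP : IsStarProjection P) (x : H) :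
    ‖(2 * P - 1) x‖ = ‖x‖ := by
  have h : inner ℂ ((2 * P - 1) x) ((2 * P - 1) x) = inner ℂ x x := by
    have := ContinuousLinearMap.isSelfAdjoint_iff_isSymmetric.1 (isSelfAdjoint_two_mul_sub_one hP)
      x ((2 * P - 1) x)
    refine this.trans ?_
    congr 1
    exact congr($(two_mul_sub_one_mul_self hP) x)
  rw [inner_self_eq_norm_sq_to_K, inner_self_eq_norm_sq_to_K] at h
  have h' : ‖(2 * P - 1) x‖ ^ 2 = ‖x‖ ^ 2 := by exact_mod_cast h
  exact (pow_left_inj₀ (norm_nonneg _) (norm_nonneg _) two_ne_zero).1 h'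

/-- A unit eigenvector of `X` for `±‖X‖` is moved by `exp (2 i X)` through the angle `2 ‖X‖`. -/
lemma exists_inner_exp_eq_cos {X : H →L[ℂ] H} (hXs : IsSelfAdjoint X) (hXc : IsCompactOperator X)
    (hX : X ≠ 0) :
    ∃ v : H, ‖v‖ = 1 ∧
      (inner ℂ v (NormedSpace.exp ((2 * Complex.I) • X) v)).re = Real.cos (2 * ‖X‖) := by
  have : Nontrivial (H →L[ℂ] H) := ⟨X, 0, hX⟩
  obtain ⟨l, hl, hlX⟩ : ∃ l : ℝ, l ∈ spectrum ℝ X ∧ (l = ‖X‖ ∨ l = -‖X‖) := by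
    rcases CStarAlgebra.norm_or_neg_norm_mem_spectrum hXs with h | h
    · exact ⟨_, h, .inl rfl⟩
    · exact ⟨_, h, .inr rfl⟩
  have hl0 : (l : ℂ) ≠ 0 := by
    have := norm_ne_zero_iff.2 hX
    rcases hlX with rfl | rfl <;> simpa
  have hlC : (l : ℂ) ∈ spectrum ℂ X := spectrum.algebraMap_mem ℂ hl
  obtain ⟨w, hw, hw0⟩ := ((hXc.hasEigenvalue_iff_mem_spectrum hl0).2 hlC).exists_hasEigenvector
  have hXw : X w = (l : ℂ) • w := Module.End.mem_eigenspace_iff.1 hw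
  refine ⟨(‖w‖ : ℂ)⁻¹ • w, norm_smul_inv_norm hw0, ?_⟩
  set v := (‖w‖ : ℂ)⁻¹ • w with hv
  have hvn : ‖v‖ = 1 := norm_smul_inv_norm hw0
  have hXv : ((2 * Complex.I) • X) v = (((2 * l : ℝ) : ℂ) * Complex.I) • v := by
    rw [smul_apply, hv, map_smul, hXw, smul_comm _ (l : ℂ), smul_smul]
    congr 1
    push_cast
    ring
  rw [exp_apply_of_apply_eq_smul hXv, inner_smul_right, inner_self_eq_norm_sq_to_K, hvn]
  norm_num [Complex.exp_ofReal_mul_I_re, -Complex.ofReal_mul]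
  rcases hlX with rfl | rfl
  · rfl
  · rw [mul_neg, Real.cos_neg]

/-- Let `R = 2 P - 1`. For a unit vector `v`, the curve `t ↦ (2 η t - 1) (R v)` runs on the unit
sphere from `v` to `exp (2 i X) v`, with at most twice the speed of `η`. -/
lemma enorm_le_curveLength {P Q X : H →L[ℂ] H} (hP : IsStarProjection P)
    (hXs : IsSelfAdjoint X) (hXc : IsCompactOperator X) (hXn : ‖X‖ ≤ Real.pi / 2)
    (hexp : NormedSpace.exp ((2 * Complex.I) • X) = (2 * Q - 1) * (2 * P - 1))
    {η : ℝ → H →L[ℂ] H} {c d : ℝ} (hη : IsPiecewiseDiffCurve (projections H) η c d)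
    (hc : η c = P) (hd : η d = Q) : ‖X‖ₑ ≤ curveLength η c d := by
  rcases eq_or_ne X 0 with rfl | hX
  · simp
  obtain ⟨v, hv, hvX⟩ := exists_inner_exp_eq_cos hXs hXc hX
  obtain ⟨F, hF⟩ := hη.differentiableAt
  let _ : InnerProductSpace ℝ H := InnerProductSpace.rclikeToReal ℂ H
  set w := (2 * P - 1) v with hw
  have hwn : ‖w‖ = 1 := (norm_two_mul_sub_one_apply hP v).trans hv
  let f : ℝ → H := fun t => (2 * η t - 1) w
  have hft (t : ℝ) : f t = (2 : ℝ) • η t w - w := by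
    simp [f, two_mul, two_smul]
  let ev : (H →L[ℂ] H) →L[ℝ] H := (ContinuousLinearMap.apply ℂ H w).restrictScalars ℝ
  have hderiv (t : ℝ) (ht : DifferentiableAt ℝ η t) :
      HasDerivAt f ((2 : ℝ) • deriv η t w) t := by
    have h1 : HasDerivAt (fun t => η t w) (deriv η t w) t :=
      ev.hasFDerivAt.comp_hasDerivAt t ht.hasDerivAt
    exact ((h1.const_smul (2 : ℝ)).sub_const w).congr_of_eventuallyEq (.of_forall hft)
  have hcont : ContinuousOn f (Set.Icc c d) := by
    refine ContinuousOn.congr ?_ fun t _ => hft t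
    exact ((ev.continuous.comp_continuousOn hη.continuousOn).const_smul (2 : ℝ)).sub
      continuousOn_const
  have hlen := arccos_inner_le_lintegral_enorm_deriv hη.le hcont F.countable_toSet
    (fun t ht htF => (hderiv t (hF t ht htF)).differentiableAt)
    (fun t ht => (norm_two_mul_sub_one_apply (hη.mem t ht) w).trans hwn)
  have hfc : f c = v := by
    simp only [f, hc, hw]
    exact congr($(two_mul_sub_one_mul_self hP) v)
  have hfd : f d = NormedSpace.exp ((2 * Complex.I) • X) v := by
    simp only [f, hd, hw, hexp]
    rfl
  have hinner : (inner ℝ (f c) (f d) : ℝ) = Real.cos (2 * ‖X‖) := by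
    rw [hfc, hfd, ← hvX]
    rfl
  rw [hinner, Real.arccos_cos (by positivity) (by linarith),
    ENNReal.ofReal_mul zero_le_two, ofReal_norm] at hlen
  have hspeed : ∫⁻ t in Set.Icc c d, ‖deriv f t‖ₑ ≤ 2 * curveLength η c d := by
    rw [curveLength, ← lintegral_const_mul' _ _ ENNReal.ofNat_ne_top,
      ← restrict_Ioo_eq_restrict_Icc]
    refine lintegral_mono_ae ?_
    filter_upwards [ae_restrict_mem measurableSet_Ioo,
      ae_restrict_of_ae (F.countable_toSet.ae_notMem volume)] with t ht htF
    rw [(hderiv t (hF t ht htF)).deriv, enorm_smul]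
    have h2 : ‖(2 : ℝ)‖ₑ = 2 := by simp [Real.enorm_eq_ofReal]
    rw [h2]
    gcongr
    rw [enorm_le_iff_norm_le]
    simpa [hwn] using (deriv η t).le_opNorm w
  have h2 : ENNReal.ofReal 2 = 2 := by simp
  rw [h2] at hlen
  exact (ENNReal.mul_le_mul_iff_right two_ne_zero ENNReal.ofNat_ne_top).1 (hlen.trans hspeed)

/-! ### The curve `t ↦ e^{itX} P e^{-itX}` -/

section ExpCurve

variable {X P : H →L[ℂ] H}

lemma star_exp_I_smul (hX : IsSelfAdjoint X) (t : ℝ) :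
    star (NormedSpace.exp ((Complex.I * t) • X)) = NormedSpace.exp (-((Complex.I * t) • X)) := by
  rw [NormedSpace.star_exp, star_smul, hX.star_eq, ← neg_smul]
  simp

lemma exp_neg_mul_exp (T : H →L[ℂ] H) : NormedSpace.exp (-T) * NormedSpace.exp T = 1 := by
  let _ : NormedAlgebra ℚ (H →L[ℂ] H) := .restrictScalars ℚ ℂ _
  rw [← NormedSpace.exp_add_of_commute (Commute.neg_left (.refl T)), neg_add_cancel,
    NormedSpace.exp_zero]

lemma exp_I_smul_mem_unitary (hX : IsSelfAdjoint X) (t : ℝ) :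
    NormedSpace.exp ((Complex.I * t) • X) ∈ unitary (H →L[ℂ] H) := by
  rw [Unitary.mem_iff, star_exp_I_smul hX]
  refine ⟨exp_neg_mul_exp _, ?_⟩
  simpa using exp_neg_mul_exp (-((Complex.I * t : ℂ) • X))

lemma isStarProjection_expCurve (hX : IsSelfAdjoint X) (hP : IsStarProjection P) (t : ℝ) :
    IsStarProjection (expCurve X P t) := by
  have h1 := star_exp_I_smul hX t
  constructor
  · rw [IsIdempotentElem, expCurve, ← mul_assoc, ← mul_assoc, mul_assoc _ (NormedSpace.exp (-_)),
      exp_neg_mul_exp, mul_one, mul_assoc _ P P, hP.isIdempotentElem.eq]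
  · rw [IsSelfAdjoint, expCurve, ← h1, star_mul, star_mul, star_star, hP.isSelfAdjoint.star_eq,
      mul_assoc]

lemma isCompactOperator_expCurve_sub (hX : IsCompactOperator X) (t : ℝ) :
    IsCompactOperator (expCurve X P t - P : H →L[ℂ] H) := by
  have h1 : IsCompactOperator ((Complex.I * t : ℂ) • X : H →L[ℂ] H) := hX.smul _
  have h2 : IsCompactOperator (-((Complex.I * t : ℂ) • X) : H →L[ℂ] H) := h1.neg
  set T : H →L[ℂ] H := (Complex.I * t : ℂ) • X with hT
  have : expCurve X P t - P = (NormedSpace.exp T - 1) * (P * NormedSpace.exp (-T))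
      + P * (NormedSpace.exp (-T) - 1) := by
    rw [expCurve, sub_mul, mul_sub, one_mul, mul_one, ← mul_assoc]
    abel
  rw [this]
  exact ((isCompactOperator_exp_sub_one h1).mul_right _).add
    ((isCompactOperator_exp_sub_one h2).mul_left P)

lemma expCurve_mem_projectionsDK {e : HilbertBasis ℕ ℂ H} (hXs : IsSelfAdjoint X)
    (hXc : IsCompactOperator X) (hP : P ∈ projectionsDK e) (t : ℝ) :
    expCurve X P t ∈ projectionsDK e := by
  refine ⟨isStarProjection_expCurve hXs hP.1 t, ?_⟩
  obtain ⟨D, K, hD, hK, hDK⟩ := hP.2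
  refine ⟨D, K + (expCurve X P t - P), hD, hK.add (isCompactOperator_expCurve_sub hXc t), ?_⟩
  rw [← add_assoc, ← hDK, add_sub_cancel]

/-- When `X` anticommutes with `2 P - 1`, the symmetry `2 δ t - 1` is `exp (2 i t X) (2 P - 1)`. -/
lemma expCurve_eq (hP : IsStarProjection P) (hXR : (2 * P - 1) * X = -(X * (2 * P - 1))) (t : ℝ) :
    expCurve X P t = (1 / 2 : ℂ) •
      (1 + NormedSpace.exp ((t : ℂ) • ((2 * Complex.I) • X)) * (2 * P - 1)) := by
  have hRR := two_mul_sub_one_mul_self hP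
  set R := 2 * P - 1 with hR
  set T : H →L[ℂ] H := (Complex.I * t : ℂ) • X with hT
  let _ : NormedAlgebra ℚ (H →L[ℂ] H) := .restrictScalars ℚ ℂ _
  have hconj : R * NormedSpace.exp (-T) = NormedSpace.exp T * R := by
    have h1 : SemiconjBy R (-T) T := by
      rw [SemiconjBy, hT, mul_neg, mul_smul_comm, hXR, smul_neg, neg_neg, smul_mul_assoc]
    exact h1.exp_right.eq
  have hsq : NormedSpace.exp ((t : ℂ) • ((2 * Complex.I) • X))
      = NormedSpace.exp T * NormedSpace.exp T := by
    rw [← NormedSpace.exp_add_of_commute (.refl T), hT]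
    congr 1
    module
  have hPR : P = (1 / 2 : ℂ) • (1 + R) := by
    rw [hR, add_sub_cancel, two_mul, ← two_smul ℂ P, smul_smul]; norm_num
  have hinv : NormedSpace.exp T * NormedSpace.exp (-T) = 1 := by
    simpa using exp_neg_mul_exp (-T)
  rw [expCurve, ← hT, hsq]
  nth_rw 1 [hPR]
  rw [mul_smul_comm, smul_mul_assoc, mul_add, add_mul, mul_one, hinv, mul_assoc _ R, hconj,
    mul_assoc]

lemma hasDerivAt_expCurve (hP : IsStarProjection P)
    (hXR : (2 * P - 1) * X = -(X * (2 * P - 1))) (t : ℝ) :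
    HasDerivAt (expCurve X P) (NormedSpace.exp ((Complex.I * (2 * t : ℝ)) • X) *
      ((Complex.I • X) * (2 * P - 1))) t := by
  have h1 : HasDerivAt (fun z : ℂ => NormedSpace.exp (z • ((2 * Complex.I) • X)))
      (NormedSpace.exp ((t : ℂ) • ((2 * Complex.I) • X)) * ((2 * Complex.I) • X)) (t : ℂ) :=
    hasDerivAt_exp_smul_const _ _
  have h2 : HasDerivAt (fun z : ℂ => (1 / 2 : ℂ) •
      (1 + NormedSpace.exp (z • ((2 * Complex.I) • X)) * (2 * P - 1)))
      ((1 / 2 : ℂ) • (NormedSpace.exp ((t : ℂ) • ((2 * Complex.I) • X)) * ((2 * Complex.I) • X) *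
        (2 * P - 1))) (t : ℂ) :=
    ((h1.mul_const (2 * P - 1)).const_add 1).const_smul (1 / 2 : ℂ)
  have h3 := h2.scomp t Complex.ofRealCLM.hasDerivAt
  have hval : (1 / 2 : ℂ) • (NormedSpace.exp ((t : ℂ) • ((2 * Complex.I) • X)) *
      ((2 * Complex.I) • X) * (2 * P - 1))
      = NormedSpace.exp ((Complex.I * (2 * t : ℝ)) • X) * ((Complex.I • X) * (2 * P - 1)) := by
    have : (t : ℂ) • ((2 * Complex.I) • X) = (Complex.I * (2 * t : ℝ)) • X := by
      rw [smul_smul]; congr 1; push_cast; ring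
    rw [this, mul_assoc, ← mul_smul_comm, ← smul_mul_assoc, smul_smul]
    congr 4
    ring
  rw [hval] at h3
  simp only [Complex.ofRealCLM_apply, Complex.ofReal_one, one_smul] at h3
  exact h3.congr_of_eventuallyEq (.of_forall fun s => expCurve_eq hP hXR s)

lemma curveLength_expCurve_le (hP : IsStarProjection P) (hXs : IsSelfAdjoint X)
    (hXR : (2 * P - 1) * X = -(X * (2 * P - 1))) :
    curveLength (expCurve X P) 0 1 ≤ ‖X‖ₑ := by
  have hRu : 2 * P - 1 ∈ unitary (H →L[ℂ] H) := by
    rw [Unitary.mem_iff, (isSelfAdjoint_two_mul_sub_one hP).star_eq]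
    exact ⟨two_mul_sub_one_mul_self hP, two_mul_sub_one_mul_self hP⟩
  have hspeed (t : ℝ) : ‖deriv (expCurve X P) t‖ₑ ≤ ‖X‖ₑ := by
    rw [(hasDerivAt_expCurve hP hXR t).deriv, enorm_le_iff_norm_le,
      CStarRing.norm_mem_unitary_mul _ (exp_I_smul_mem_unitary hXs _),
      CStarRing.norm_mul_mem_unitary _ hRu, norm_smul Complex.I X, Complex.norm_I, one_mul]
  calc curveLength (expCurve X P) 0 1 ≤ ∫⁻ _ in Set.Icc (0 : ℝ) 1, ‖X‖ₑ :=
        lintegral_mono hspeed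
    _ = ‖X‖ₑ := by simp

lemma isPiecewiseDiffCurve_expCurve {S : Set (H →L[ℂ] H)} (hP : IsStarProjection P)
    (hXR : (2 * P - 1) * X = -(X * (2 * P - 1)))
    (hS : ∀ t ∈ Set.Icc (0 : ℝ) 1, expCurve X P t ∈ S) :
    IsPiecewiseDiffCurve S (expCurve X P) 0 1 where
  le := zero_le_one
  continuousOn t _ := (hasDerivAt_expCurve hP hXR t).continuousAt.continuousWithinAt
  differentiableAt := ⟨∅, fun t _ _ => (hasDerivAt_expCurve hP hXR t).differentiableAt⟩
  mem := hS

end ExpCurve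

end Length

end DiagCompact

theorem mainTheorem10 {H : Type*} [NormedAddCommGroup H] [InnerProductSpace ℂ H] [CompleteSpace H]
    (e : HilbertBasis ℕ ℂ H) (P Q : H →L[ℂ] H)
    (hP : P ∈ DiagCompact.projectionsDK e) (hQ : Q ∈ DiagCompact.projectionsDK e)
    (hPQ : Q ∈ connectedComponentIn (DiagCompact.projectionsDK e) P) :
    ∃ X : H →L[ℂ] H, IsSelfAdjoint X ∧ IsCompactOperator X ∧ ‖X‖ ≤ Real.pi / 2 ∧
      DiagCompact.expCurve X P 0 = P ∧ DiagCompact.expCurve X P 1 = Q ∧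
      (∀ t ∈ Set.Icc (0 : ℝ) 1, DiagCompact.expCurve X P t ∈ DiagCompact.projectionsDK e) ∧
      DiagCompact.IsMinimalCurve (DiagCompact.projections H) (DiagCompact.expCurve X P) 0 1 ∧
      DiagCompact.IsMinimalCurve (DiagCompact.projectionsDK e) (DiagCompact.expCurve X P) 0 1 := by
  have hconj := DiagCompact.compactlyConjugate_of_mem_connectedComponentIn hP hPQ
  obtain ⟨X, hXs, hXc, hXn, hXR, hexp⟩ := DiagCompact.exists_compact_log hP.1 hQ.1
    hconj.isCompactOperator_sub (DiagCompact.finrank_rangeInfKer_eq hP.1 hQ.1 hconj)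
  have h0 : DiagCompact.expCurve X P 0 = P := by simp [DiagCompact.expCurve]
  have h1 : DiagCompact.expCurve X P 1 = Q := by
    rw [DiagCompact.expCurve_eq hP.1 hXR, Complex.ofReal_one, one_smul, hexp, mul_assoc,
      DiagCompact.two_mul_sub_one_mul_self hP.1, mul_one, add_sub_cancel, two_mul,
      ← two_smul ℂ Q, smul_smul]
    norm_num
  have hmem (t : ℝ) := DiagCompact.expCurve_mem_projectionsDK hXs hXc hP t
  have hmin {η : ℝ → H →L[ℂ] H} {c d : ℝ}
      (hη : DiagCompact.IsPiecewiseDiffCurve (DiagCompact.projections H) η c d)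
      (hc : η c = DiagCompact.expCurve X P 0) (hd : η d = DiagCompact.expCurve X P 1) :
      DiagCompact.curveLength (DiagCompact.expCurve X P) 0 1 ≤ DiagCompact.curveLength η c d :=
    (DiagCompact.curveLength_expCurve_le hP.1 hXs hXR).trans
      (DiagCompact.enorm_le_curveLength hP.1 hXs hXc hXn hexp hη (hc.trans h0) (hd.trans h1))
  refine ⟨X, hXs, hXc, hXn, h0, h1, fun t _ => hmem t, ⟨?_, fun η c d hη hc hd => hmin hη hc hd⟩,
    ?_, fun η c d hη hc hd => hmin ⟨hη.le, hη.continuousOn, hη.differentiableAt,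
      fun t ht => (hη.mem t ht).1⟩ hc hd⟩
  · exact DiagCompact.isPiecewiseDiffCurve_expCurve hP.1 hXR fun t _ => (hmem t).1
  · exact DiagCompact.isPiecewiseDiffCurve_expCurve hP.1 hXR fun t _ => hmem t
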